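/- **Theorem (Bertozzini–Conti–Lewkeeratiyutkul; spectral theorem for imprimitivity bimodules).** Let $A$ and $B$ be Abelian unital $C^*$-algebras and let ${}_AM_B$ be an imprimitivity Hilbert $C^*$-bimodule. That is, $M$ is a unital bimodule over the complex algebras $A$ and $B$ (with $(a\cdot x)\cdot b=a\cdot(x\cdot b)$, and with the scalars $\mathbb{C}1_A$ and $\mathbb{C}1_B$ acting on $M$ through the same complex vector space structure), a left Hilbert $C^*$-module over $A$ with inner product ${}_A\langle x,y\rangle$ (linear in $x$) and a right Hilbert $C^*$-module over $B$ with inner product $\langle x,y\rangle_B$ (linear in $y$), complete for both norms; the values of each inner product span a dense subspace of $A$, respectively $B$; and ${}_A\langle x,y\rangle\cdot z=x\cdot\langle y,z\rangle_B$ for all $x,y,z\in M$. Write $\mathrm{Sp}(A)$ for the space of characters of $A$ with the weak-$*$ topology. For a homeomorphism $R:\mathrm{Sp}(A)\to\mathrm{Sp}(B)$, identify $R$ with its graph, a compact subspace of $\mathrm{Sp}(A)\times\mathrm{Sp}(B)$, and let $\pi_A^\bullet:A\to C(R;\mathbb{C})$, $\pi_A^\bullet(a)(\omega,\omega')=\omega(a)$,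 and $\pi_B^\bullet:B\to C(R;\mathbb{C})$, $\pi_B^\bullet(b)(\omega,\omega')=\omega'(b)$, be the pull-back isomorphisms. For a Hermitian line bundle $E$ over $R$ (a locally trivial complex line bundle with continuously varying inner products, linear in the second variable, on the fibres), let $\Gamma(R;E)$ be the symmetric $C(R;\mathbb{C})$-bimodule of continuous sections, with right inner product $p\mapsto\langle\sigma(p),\tau(p)\rangle$ and left inner product $p\mapsto\langle\tau(p),\sigma(p)\rangle$ of $\sigma,\tau$. Its twisting ${}_{\pi_A^\bullet}\Gamma(R;E)_{\pi_B^\bullet}$ is the $A$-$B$-bimodule with $a\cdot\sigma=\pi_A^\bullet(a)\sigma$ and $\sigma\cdot b=\sigma\,\pi_B^\bullet(b)$, with the inner products carried to $A$ and $B$ by $(\pi_A^\bullet)^{-1}$ and $(\pi_B^\bullet)^{-1}$. An isomorphism of Hilbert bimodules is a linear bijection that commutes with both actions and preserves both inner products. Then there is a homeomorphism $R_{BA}:\mathrm{Sp}(A)\to\mathrm{Sp}(B)$ such that: 1. $R_{BA}$ is canonical: for all $a\in A$ and $b\in B$, one has $a\cdot x=x\cdot b$ for all $x\in M$ if and only if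 $\omega(a)=R_{BA}(\omega)(b)$ for all $\omega\in\mathrm{Sp}(A)$; 2. there is a Hermitian line bundle $E$ over $R_{BA}$ such that $M\cong{}_{\pi_A^\bullet}\Gamma(R_{BA};E)_{\pi_B^\bullet}$ as Hilbert bimodules, and $E$ is unique up to isomorphism: every Hermitian line bundle $E'$ over $R_{BA}$ with this property is isomorphic to $E$ by fibrewise unitary maps that form a homeomorphism of total spaces over the identity of $R_{BA}$; 3. $R_{BA}$ is unique: if $R'$ is a homeomorphism $\mathrm{Sp}(A)\to\mathrm{Sp}(B)$ and $E'$ a Hermitian line bundle over $R'$ with $M\cong{}_{\pi_A^\bullet}\Gamma(R';E')_{\pi_B^\bullet}$, the pull-backs being those of $R'$, then $R'=R_{BA}$. -/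

import Mathlib

open Bundle Topology

universe uA uB uM uX uE uE'

noncomputable section

/-! ### Hilbert C*-modules and bimodules

`M` is a left `A`-module and a right `B`-module (a `Bᵐᵒᵖ`-module); `x · b` is `MulOpposite.op b • x`.
-/

/-- An `A`-valued pairing on `M`, to be used as the inner product of a left module. -/
class LeftInner (A : Type*) (M : Type*) where
  /-- the pairing `(x, y) ↦ ₐ⟨x, y⟩` -/
  leftInner : M → M → A

/-- A `B`-valued pairing on `M`, to be used as the inner product of a right module. -/
class RightInner (B : Type*) (M : Type*) where
  /-- the pairing `(x, y) ↦ ⟨x, y⟩_B` -/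
  rightInner : M → M → B

open LeftInner (leftInner)
open RightInner (rightInner)

/-- `M` is a left Hilbert C*-module over `A`: the inner product is linear in the first variable,
Hermitian, positive and definite, and `M` is complete for the norm `‖ₐ⟨x, x⟩‖ ^ (1/2)`. -/
structure IsLeftHilbertModule (A : Type*) [CStarAlgebra A] (M : Type*) [AddCommGroup M]
    [Module A M] [LeftInner A M] : Prop where
  add_left : ∀ x y z : M, (leftInner (x + y) z : A) = leftInner x z + leftInner y z
  smul_left : ∀ (a : A) (x z : M), (leftInner (a • x) z : A) = a * leftInner x z
  symm : ∀ x y : M, (leftInner y x : A) = star (leftInner x y)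
  nonneg : ∀ x : M, ∃ a : A, leftInner x x = star a * a
  definite : ∀ x : M, (leftInner x x : A) = 0 → x = 0
  complete : ∀ u : ℕ → M,
    (∀ ε > 0, ∃ N, ∀ m ≥ N, ∀ n ≥ N, √‖(leftInner (u m - u n) (u m - u n) : A)‖ < ε) →
    ∃ x : M, ∀ ε > 0, ∃ N, ∀ n ≥ N, √‖(leftInner (u n - x) (u n - x) : A)‖ < ε

/-- `M` is a right Hilbert C*-module over `B`: the inner product is linear in the second variable,
Hermitian, positive and definite, and `M` is complete for the norm `‖⟨x, x⟩_B‖ ^ (1/2)`. -/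
structure IsRightHilbertModule (B : Type*) [CStarAlgebra B] (M : Type*) [AddCommGroup M]
    [Module Bᵐᵒᵖ M] [RightInner B M] : Prop where
  add_right : ∀ x y z : M, (rightInner x (y + z) : B) = rightInner x y + rightInner x z
  smul_right : ∀ (b : B) (x z : M),
    (rightInner x (MulOpposite.op b • z) : B) = rightInner x z * b
  symm : ∀ x y : M, (rightInner y x : B) = star (rightInner x y)
  nonneg : ∀ x : M, ∃ b : B, rightInner x x = star b * b
  definite : ∀ x : M, (rightInner x x : B) = 0 → x = 0
  complete : ∀ u : ℕ → M,
    (∀ ε > 0, ∃ N, ∀ m ≥ N, ∀ n ≥ N, √‖(rightInner (u m - u n) (u m - u n) : B)‖ < ε) →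
    ∃ x : M, ∀ ε > 0, ∃ N, ∀ n ≥ N, √‖(rightInner (u n - x) (u n - x) : B)‖ < ε

/-- `M` is an imprimitivity Hilbert C*-bimodule over `A` and `B`: a Hilbert C*-bimodule, full on
both sides, with `ₐ⟨x, y⟩ · z = x · ⟨y, z⟩_B`. The class arguments say that `M` is a bimodule over
the complex algebras `A` and `B`: the two actions commute, and the scalars of `A` and of `B` act
on `M` through one and the same complex vector space structure. -/
structure IsImprimitivityBimodule (A B M : Type*) [CStarAlgebra A] [CStarAlgebra B]
    [AddCommGroup M] [Module ℂ M] [Module A M] [Module Bᵐᵒᵖ M]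
    [SMulCommClass A Bᵐᵒᵖ M] [IsScalarTower ℂ A M] [IsScalarTower ℂ Bᵐᵒᵖ M]
    [LeftInner A M] [RightInner B M] : Prop where
  left : IsLeftHilbertModule A M
  right : IsRightHilbertModule B M
  full_left :
    Dense (Submodule.span ℂ (Set.range fun p : M × M => (leftInner p.1 p.2 : A)) : Set A)
  full_right :
    Dense (Submodule.span ℂ (Set.range fun p : M × M => (rightInner p.1 p.2 : B)) : Set B)
  imprimitivity : ∀ x y z : M,
    (leftInner x y : A) • z = MulOpposite.op (rightInner y z : B) • x

/-- An isomorphism of Hilbert C*-bimodules over `A` and `B`: a linear bijection that commutes with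
both actions and preserves both inner products. -/
structure HilbertBimoduleIso (A B M N : Type*)
    [AddCommGroup M] [Module ℂ M] [AddCommGroup N] [Module ℂ N]
    [SMul A M] [SMul Bᵐᵒᵖ M] [LeftInner A M] [RightInner B M]
    [SMul A N] [SMul Bᵐᵒᵖ N] [LeftInner A N] [RightInner B N] extends M ≃ₗ[ℂ] N where
  map_smul_left : ∀ (a : A) (x : M), toFun (a • x) = a • toFun x
  map_smul_right : ∀ (b : B) (x : M),
    toFun (MulOpposite.op b • x) = MulOpposite.op b • toFun x
  map_leftInner : ∀ x y : M, (leftInner (toFun x) (toFun y) : A) = leftInner x y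
  map_rightInner : ∀ x y : M, (rightInner (toFun x) (toFun y) : B) = rightInner x y

/-! ### Twisting -/

/-- The twisting of a Hilbert bimodule `N` over `C` and `D` on the left by an isomorphism
`φ : A → C` and on the right by an isomorphism `ψ : B → D`: a bimodule over `A` and `B` with
`a · x = φ a · x`, `x · b = x · ψ b`, and with inner products transported along `φ` and `ψ`. -/
@[nolint unusedArguments]
def Twist {A B C D : Type*} [CStarAlgebra A] [CStarAlgebra B] [CStarAlgebra C] [CStarAlgebra D]
    (_ : A ≃⋆ₐ[ℂ] C) (_ : B ≃⋆ₐ[ℂ] D) (N : Type*) : Type _ := N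

namespace Twist

variable {A B C D : Type*} [CStarAlgebra A] [CStarAlgebra B] [CStarAlgebra C] [CStarAlgebra D]
  (φ : A ≃⋆ₐ[ℂ] C) (ψ : B ≃⋆ₐ[ℂ] D) (N : Type*) [AddCommGroup N] [Module ℂ N]

instance : AddCommGroup (Twist φ ψ N) := inferInstanceAs (AddCommGroup N)

instance : Module ℂ (Twist φ ψ N) := inferInstanceAs (Module ℂ N)

instance [Module C N] : Module A (Twist φ ψ N) :=
  Module.compHom N (φ : A →+* C)

instance [Module Dᵐᵒᵖ N] : Module Bᵐᵒᵖ (Twist φ ψ N) :=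
  Module.compHom N (RingHom.op (ψ : B →+* D))

instance [LeftInner C N] : LeftInner A (Twist φ ψ N) where
  leftInner x y := φ.symm (leftInner (show N from x) (show N from y))

instance [RightInner D N] : RightInner B (Twist φ ψ N) where
  rightInner x y := ψ.symm (rightInner (show N from x) (show N from y))

end Twist

/-! ### Hermitian line bundles and their sections -/

/-- A Hermitian line bundle over `X`: a (locally trivial) complex vector bundle with fibre `ℂ` and
a complex inner product on every fibre that varies continuously. Continuity is imposed on the norm
function on the total space; by polarization this is continuity of the inner product. -/
structure HermitianLineBundle (X : Type uX) [TopologicalSpace X] where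
  /-- the fibres -/
  Fiber : X → Type uE
  [normedAddCommGroup : ∀ x, NormedAddCommGroup (Fiber x)]
  [innerProductSpace : ∀ x, InnerProductSpace ℂ (Fiber x)]
  [topologicalSpace : TopologicalSpace (TotalSpace ℂ Fiber)]
  [fiberBundle : FiberBundle ℂ Fiber]
  [vectorBundle : VectorBundle ℂ ℂ Fiber]
  continuous_norm : Continuous fun v : TotalSpace ℂ Fiber => ‖v.2‖

namespace HermitianLineBundle

attribute [instance] normedAddCommGroup innerProductSpace topologicalSpace fiberBundle vectorBundle

variable {X : Type uX} [TopologicalSpace X]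

/-- An isomorphism of Hermitian line bundles over the same base: fibrewise unitary maps that form
a homeomorphism of the total spaces. -/
structure Iso (E : HermitianLineBundle.{uX, uE} X) (E' : HermitianLineBundle.{uX, uE'} X) where
  /-- the unitary map on each fibre -/
  fiberIso : ∀ x, E.Fiber x ≃ₗᵢ[ℂ] E'.Fiber x
  continuous_toFun : Continuous fun v : TotalSpace ℂ E.Fiber =>
    (⟨v.proj, fiberIso v.proj v.2⟩ : TotalSpace ℂ E'.Fiber)
  continuous_invFun : Continuous fun v : TotalSpace ℂ E'.Fiber =>
    (⟨v.proj, (fiberIso v.proj).symm v.2⟩ : TotalSpace ℂ E.Fiber)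

variable (E : HermitianLineBundle.{uX, uE} X)

/-- The section `s` of `E` is continuous. -/
def IsContinuousSection (s : ∀ x, E.Fiber x) : Prop :=
  Continuous fun x => TotalSpace.mk' ℂ x (s x)

variable {E}

theorem IsContinuousSection.zero : E.IsContinuousSection 0 :=
  Bundle.Trivialization.continuous_zeroSection ℂ

theorem IsContinuousSection.add {s t : ∀ x, E.Fiber x} (hs : E.IsContinuousSection s)
    (ht : E.IsContinuousSection t) : E.IsContinuousSection (s + t) := by
  refine continuous_iff_continuousAt.2 fun x => ?_
  rw [FiberBundle.continuousAt_section]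
  have hs' := (FiberBundle.continuousAt_section ℂ x).1 hs.continuousAt
  have ht' := (FiberBundle.continuousAt_section ℂ x).1 ht.continuousAt
  refine (hs'.add ht').congr_of_eventuallyEq ?_
  filter_upwards [(trivializationAt ℂ E.Fiber x).open_baseSet.mem_nhds
    (FiberBundle.mem_baseSet_trivializationAt ℂ E.Fiber x)] with y hy
  exact ((trivializationAt ℂ E.Fiber x).linear ℂ hy).map_add (s y) (t y)

theorem IsContinuousSection.mul {s : ∀ x, E.Fiber x} (hs : E.IsContinuousSection s)
    {f : X → ℂ} (hf : Continuous f) : E.IsContinuousSection fun x => f x • s x := by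
  refine continuous_iff_continuousAt.2 fun x => ?_
  rw [FiberBundle.continuousAt_section]
  have hs' := (FiberBundle.continuousAt_section ℂ x).1 hs.continuousAt
  refine (hf.continuousAt.smul hs').congr_of_eventuallyEq ?_
  filter_upwards [(trivializationAt ℂ E.Fiber x).open_baseSet.mem_nhds
    (FiberBundle.mem_baseSet_trivializationAt ℂ E.Fiber x)] with y hy
  exact ((trivializationAt ℂ E.Fiber x).linear ℂ hy).map_smul (f y) (s y)

variable (E)

/-- The space `Γ(X; E)` of continuous sections of `E`. -/
def sections : Submodule ℂ (∀ x, E.Fiber x) where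
  carrier := {s | E.IsContinuousSection s}
  add_mem' := IsContinuousSection.add
  zero_mem' := IsContinuousSection.zero
  smul_mem' _ _ hs := hs.mul continuous_const

/-- The left action of `C(X; ℂ)` on sections is pointwise multiplication. -/
instance : Module C(X, ℂ) E.sections where
  smul f s := ⟨fun x => f x • s.1 x, IsContinuousSection.mul s.2 f.continuous⟩
  one_smul s := Subtype.ext (funext fun x => one_smul ℂ (s.1 x))
  mul_smul f g s := Subtype.ext (funext fun x => mul_smul (f x) (g x) (s.1 x))
  smul_zero f := Subtype.ext (funext fun x => smul_zero (f x))
  smul_add f s t := Subtype.ext (funext fun x => smul_add (f x) (s.1 x) (t.1 x))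
  add_smul f g s := Subtype.ext (funext fun x => add_smul (f x) (g x) (s.1 x))
  zero_smul s := Subtype.ext (funext fun x => zero_smul ℂ (s.1 x))

/-- The right action of `C(X; ℂ)` on sections: `s · f = f · s`, so the bimodule is symmetric. -/
instance : Module C(X, ℂ)ᵐᵒᵖ E.sections :=
  Module.compHom E.sections
    ((RingEquiv.toOpposite C(X, ℂ)).symm : C(X, ℂ)ᵐᵒᵖ →+* C(X, ℂ))

theorem continuous_inner (s t : E.sections) :
    Continuous fun x => inner ℂ (s.1 x) (t.1 x) := by
  have hn : ∀ r : E.sections, Continuous fun x => ((‖r.1 x‖ : ℝ) : ℂ) := fun r =>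
    Complex.continuous_ofReal.comp (E.continuous_norm.comp r.2)
  have h1 := hn (s + t)
  have h2 := hn (s - t)
  have h3 := hn (s - Complex.I • t)
  have h4 := hn (s + Complex.I • t)
  have h := (((h1.pow 2).sub (h2.pow 2)).add
    (((h3.pow 2).sub (h4.pow 2)).mul (continuous_const (y := Complex.I)))).div_const 4
  refine h.congr fun x => ?_
  exact (inner_eq_sum_norm_sq_div_four (𝕜 := ℂ) (s.1 x) (t.1 x)).symm

/-- The right inner product `⟨s, t⟩ : x ↦ ⟨s x, t x⟩`, linear in the second variable. -/
instance : RightInner C(X, ℂ) E.sections where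
  rightInner s t := ⟨fun x => inner ℂ (s.1 x) (t.1 x), E.continuous_inner s t⟩

/-- The left inner product `⟨s, t⟩ : x ↦ ⟨t x, s x⟩`, linear in the first variable. -/
instance : LeftInner C(X, ℂ) E.sections where
  leftInner s t := ⟨fun x => inner ℂ (t.1 x) (s.1 x), E.continuous_inner t s⟩

end HermitianLineBundle

/-! ### Spectra, the graph of a homeomorphism, and the pull-back isomorphisms -/

/-- The Gelfand spectrum of `A`: its characters, with the weak-* topology. -/
abbrev Sp (A : Type*) [CommCStarAlgebra A] : Type _ := WeakDual.characterSpace ℂ A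

/-- The graph of a homeomorphism, with the subspace topology of the product. -/
abbrev Homeomorph.Graph {X Y : Type*} [TopologicalSpace X] [TopologicalSpace Y] (R : X ≃ₜ Y) :
    Type _ := {p : X × Y // p.2 = R p.1}

/-- The first projection of the graph. -/
def Homeomorph.graphFst {X Y : Type*} [TopologicalSpace X] [TopologicalSpace Y] (R : X ≃ₜ Y) :
    R.Graph ≃ₜ X where
  toFun p := p.1.1
  invFun x := ⟨(x, R x), rfl⟩
  left_inv p := Subtype.ext (Prod.ext rfl p.2.symm)
  right_inv _ := rfl
  continuous_toFun := by fun_prop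
  continuous_invFun := by fun_prop

/-- The second projection of the graph. -/
def Homeomorph.graphSnd {X Y : Type*} [TopologicalSpace X] [TopologicalSpace Y] (R : X ≃ₜ Y) :
    R.Graph ≃ₜ Y where
  toFun p := p.1.2
  invFun y := ⟨(R.symm y, y), (R.apply_symm_apply y).symm⟩
  left_inv p := Subtype.ext (Prod.ext (by simp [p.2]) rfl)
  right_inv _ := rfl
  continuous_toFun := by fun_prop
  continuous_invFun := by fun_prop

section Pullback

variable {A : Type uA} {B : Type uB} [CommCStarAlgebra A] [CommCStarAlgebra B] (R : Sp A ≃ₜ Sp B)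

instance : CompactSpace R.Graph := R.graphFst.symm.compactSpace

/-- The pull-back isomorphism `A → C(R; ℂ)`: the Gelfand transform followed by composition with
the first projection of the graph of `R`. -/
def pullbackLeft : A ≃⋆ₐ[ℂ] C(R.Graph, ℂ) :=
  (gelfandStarTransform A).trans (R.graphFst.compStarAlgEquiv' ℂ ℂ)

/-- The pull-back isomorphism `B → C(R; ℂ)`: the Gelfand transform followed by composition with
the second projection of the graph of `R`. -/
def pullbackRight : B ≃⋆ₐ[ℂ] C(R.Graph, ℂ) :=
  (gelfandStarTransform B).trans (R.graphSnd.compStarAlgEquiv' ℂ ℂ)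

theorem pullbackLeft_apply (a : A) (p : R.Graph) : pullbackLeft R a p = p.1.1 a := rfl

theorem pullbackRight_apply (b : B) (p : R.Graph) : pullbackRight R b p = p.1.2 b := rfl

/-- The `A`-`B`-bimodule of continuous sections of a Hermitian line bundle over the graph of `R`,
twisted on the left and on the right by the pull-back isomorphisms. -/
abbrev TwistedSections (E : HermitianLineBundle.{max uA uB, uE} R.Graph) : Type _ :=
  Twist (pullbackLeft R) (pullbackRight R) E.sections

/-- `R` is the homeomorphism of spectra induced by the bimodule `M`: an element `a` of `A` acts on
`M` as an element `b` of `B` does if and only if their Gelfand transforms agree along `R`. -/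
def IsInducedBy (M : Type*) [SMul A M] [SMul Bᵐᵒᵖ M] : Prop :=
  ∀ (a : A) (b : B),
    (∀ x : M, a • x = MulOpposite.op b • x) ↔ ∀ ω : Sp A, ω a = R ω b

end Pullback

end

open Bundle Topology

open LeftInner (leftInner)
open RightInner (rightInner)

noncomputable section
-- Fullness yields finite sums `∑ ₐ⟨uᵢ, vᵢ⟩ = 1` and `∑ ⟨uᵢ, vᵢ⟩_B = 1`, since a dense ideal of a
-- unital C*-algebra contains `1`. With the imprimitivity identity these sums show that every `a`
-- acts on `M` as exactly one `b`, and conversely (`exists_right_eq_left`, `exists_left_eq_right`).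
-- This gives an isomorphism `e : A ≃ B`, and the homeomorphism is `ω ↦ ω ∘ e⁻¹`.
--
-- At a character `ω` the form `(x, y) ↦ ω(ₐ⟨x, y⟩)` has rank one (`apply_leftInner_eq`), so `M`
-- modulo its null vectors at `ω` is a Hermitian line. A vector `e_ω` of length one at `ω` is chosen
-- for each `ω`. It remains nonzero near `ω` and serves there as a local frame. The transition
-- functions are quotients of Gram entries, hence continuous even though `ω ↦ e_ω` is an arbitrary
-- choice (`RankOneGram`). Elements of `M` become sections. This map is injective by definiteness
-- and surjective because the `uᵢ`, `vᵢ` form a finite frame (`toSectionHom_surjective`). The right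
-- inner product follows from the left one through `e` (`algEquiv_symm_rightInner`).
--
-- For uniqueness of the bundle, pointwise norms of sections are read off from `ω(ₐ⟨x, x⟩)`, so an
-- isomorphism of sections descends to the fibres. For uniqueness of the homeomorphism, elements of
-- `A` and `B` with the same pull-back act equally on sections, hence on `M`.
/-! ### Dense sets of inner products -/

/-- A family whose complex span is dense in a commutative unital C*-algebra generates the unit
ideal. -/
theorem exists_sum_mul_eq_one_of_dense {A ι : Type*} [CommCStarAlgebra A] (f : ι → A)
    (hf : Dense (Submodule.span ℂ (Set.range f) : Set A)) :
    ∃ c : ι →₀ A, c.sum (fun i a => a * f i) = 1 := by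
  have hle : (Submodule.span ℂ (Set.range f) : Set A) ⊆ (Ideal.span (Set.range f) : Set A) := by
    intro a ha
    induction ha using Submodule.span_induction with
    | mem a ha => exact Ideal.subset_span ha
    | zero => exact Ideal.zero_mem _
    | add a b _ _ ha hb => exact Ideal.add_mem _ ha hb
    | smul c a _ ha =>
      rw [← one_mul a, ← smul_mul_assoc]
      exact Ideal.mul_mem_left _ _ ha
  -- The closure of a proper ideal is proper, because the units form an open set.
  have htop : Ideal.span (Set.range f) = ⊤ := by
    by_contra h
    refine Ideal.closure_ne_top _ h (SetLike.coe_injective ?_)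
    rw [Ideal.coe_closure, (hf.mono hle).closure_eq]
    rfl
  exact Finsupp.mem_ideal_span_range_iff_exists_finsupp.1 (htop ▸ Submodule.mem_top)

section LeftModule

variable {A M : Type*} [CStarAlgebra A] [AddCommGroup M] [Module A M] [LeftInner A M]

namespace IsLeftHilbertModule

theorem zero_left (h : IsLeftHilbertModule A M) (y : M) : (leftInner 0 y : A) = 0 := by
  simpa using h.smul_left 0 0 y

theorem sum_left (h : IsLeftHilbertModule A M) {ι : Type*} (s : Finset ι) (f : ι → M) (y : M) :
    (leftInner (∑ i ∈ s, f i) y : A) = ∑ i ∈ s, leftInner (f i) y := by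
  classical
  induction s using Finset.induction_on with
  | empty => simpa using h.zero_left y
  | insert i s hi ih => rw [Finset.sum_insert hi, Finset.sum_insert hi, h.add_left, ih]

end IsLeftHilbertModule

end LeftModule

/-! ### The isomorphism of algebras given by the two actions -/

namespace IsImprimitivityBimodule

variable {A : Type uA} {B : Type uB} {M : Type uM} [CommCStarAlgebra A] [CommCStarAlgebra B]
    [AddCommGroup M] [Module ℂ M] [Module A M] [Module Bᵐᵒᵖ M]
    [SMulCommClass A Bᵐᵒᵖ M] [IsScalarTower ℂ A M] [IsScalarTower ℂ Bᵐᵒᵖ M]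
    [LeftInner A M] [RightInner B M]

/-- The coefficients in `A` produced by fullness are absorbed into the first variable. -/
theorem exists_sum_leftInner (hM : IsImprimitivityBimodule A B M) :
    ∃ (s : Finset (M × M)) (u v : M × M → M), ∑ i ∈ s, (leftInner (u i) (v i) : A) = 1 := by
  obtain ⟨c, hc⟩ := exists_sum_mul_eq_one_of_dense _ hM.full_left
  refine ⟨c.support, fun p => c p • p.1, Prod.snd, ?_⟩
  simp_rw [hM.left.smul_left]
  exact hc

theorem exists_sum_rightInner (hM : IsImprimitivityBimodule A B M) :
    ∃ (s : Finset (M × M)) (u v : M × M → M), ∑ i ∈ s, (rightInner (u i) (v i) : B) = 1 := by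
  obtain ⟨c, hc⟩ := exists_sum_mul_eq_one_of_dense _ hM.full_right
  refine ⟨c.support, Prod.fst, fun p => MulOpposite.op (c p) • p.2, ?_⟩
  simp_rw [hM.right.smul_right, mul_comm _ (c _)]
  exact hc

/-- Both actions of an imprimitivity bimodule are faithful. -/
theorem left_faithful (hM : IsImprimitivityBimodule A B M) {a a' : A}
    (h : ∀ x : M, a • x = a' • x) : a = a' := by
  obtain ⟨s, u, v, h1⟩ := hM.exists_sum_leftInner
  rw [← mul_one a, ← mul_one a', ← h1, Finset.mul_sum, Finset.mul_sum]
  simp_rw [← hM.left.smul_left, h]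

theorem right_faithful (hM : IsImprimitivityBimodule A B M) {b b' : B}
    (h : ∀ x : M, MulOpposite.op b • x = MulOpposite.op b' • x) : b = b' := by
  obtain ⟨s, u, v, h1⟩ := hM.exists_sum_rightInner
  rw [← one_mul b, ← one_mul b', ← h1, Finset.sum_mul, Finset.sum_mul]
  simp_rw [← hM.right.smul_right, h]

/-- With `∑ ⟨uᵢ, vᵢ⟩_B = 1`, one has `a · x = ∑ a · (ₐ⟨x, uᵢ⟩ · vᵢ)`. Commutativity of `A` moves `a`
onto `vᵢ`, and imprimitivity turns the sum into `x · ∑ ⟨uᵢ, a · vᵢ⟩_B`. -/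
theorem exists_right_eq_left (hM : IsImprimitivityBimodule A B M) (a : A) :
    ∃ b : B, ∀ x : M, a • x = MulOpposite.op b • x := by
  obtain ⟨s, u, v, h1⟩ := hM.exists_sum_rightInner
  refine ⟨∑ i ∈ s, rightInner (u i) (a • v i), fun x => ?_⟩
  rw [Finset.op_sum, Finset.sum_smul]
  simp_rw [← hM.imprimitivity, smul_smul, mul_comm _ a, ← smul_smul, ← Finset.smul_sum,
    hM.imprimitivity, ← Finset.sum_smul, ← Finset.op_sum, h1, MulOpposite.op_one, one_smul]

theorem exists_left_eq_right (hM : IsImprimitivityBimodule A B M) (b : B) :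
    ∃ a : A, ∀ x : M, a • x = MulOpposite.op b • x := by
  obtain ⟨s, u, v, h1⟩ := hM.exists_sum_leftInner
  refine ⟨∑ i ∈ s, leftInner (MulOpposite.op b • u i) (v i), fun x => ?_⟩
  rw [Finset.sum_smul]
  simp_rw [hM.imprimitivity, smul_smul, mul_comm _ (MulOpposite.op b), ← smul_smul,
    ← Finset.smul_sum, ← hM.imprimitivity, ← Finset.sum_smul, h1, one_smul]

/-- The isomorphism `A ≃ B` that takes `a` to the element acting on `M` from the right as `a` acts
from the left. -/
def algEquiv (hM : IsImprimitivityBimodule A B M) : A ≃ₐ[ℂ] B :=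
  AlgEquiv.ofBijective
    { toFun := fun a => (hM.exists_right_eq_left a).choose
      map_one' := hM.right_faithful fun x => by
        rw [← (hM.exists_right_eq_left 1).choose_spec, one_smul, MulOpposite.op_one, one_smul]
      map_zero' := hM.right_faithful fun x => by
        rw [← (hM.exists_right_eq_left 0).choose_spec, zero_smul, MulOpposite.op_zero, zero_smul]
      -- Passing to a right action reverses products; commutation of the two actions restores the
      -- order.
      map_mul' := fun a a' => hM.right_faithful fun x => by
        rw [← (hM.exists_right_eq_left _).choose_spec, mul_smul, MulOpposite.op_mul, mul_smul,
          ← (hM.exists_right_eq_left a).choose_spec, ← smul_comm,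
          ← (hM.exists_right_eq_left a').choose_spec]
      map_add' := fun a a' => hM.right_faithful fun x => by
        rw [← (hM.exists_right_eq_left _).choose_spec, add_smul, MulOpposite.op_add, add_smul,
          ← (hM.exists_right_eq_left a).choose_spec, ← (hM.exists_right_eq_left a').choose_spec]
      -- Both scalar actions come from the same complex structure on `M`.
      commutes' := fun c => hM.right_faithful fun x => by
        rw [← (hM.exists_right_eq_left _).choose_spec, Algebra.algebraMap_eq_smul_one,
          Algebra.algebraMap_eq_smul_one, MulOpposite.op_smul, smul_assoc, smul_assoc,
          MulOpposite.op_one, one_smul, one_smul] }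
    ⟨fun a a' h => hM.left_faithful fun x => by
        rw [(hM.exists_right_eq_left a).choose_spec, (hM.exists_right_eq_left a').choose_spec]
        exact congrArg (fun b : B => MulOpposite.op b • x) h,
      fun b => by
        obtain ⟨a, ha⟩ := hM.exists_left_eq_right b
        refine ⟨a, hM.right_faithful fun x => ?_⟩
        rw [← ha]
        exact ((hM.exists_right_eq_left a).choose_spec x).symm⟩

theorem algEquiv_smul (hM : IsImprimitivityBimodule A B M) (a : A) (x : M) :
    MulOpposite.op (hM.algEquiv a) • x = a • x :=
  ((hM.exists_right_eq_left a).choose_spec x).symm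

theorem algEquiv_symm_smul (hM : IsImprimitivityBimodule A B M) (b : B) (x : M) :
    hM.algEquiv.symm b • x = MulOpposite.op b • x := by
  rw [← hM.algEquiv_smul, AlgEquiv.apply_symm_apply]

/-! ### Values of the inner products at a character -/

/-- Both sides are the value at `ω` of `ₐ⟨ₐ⟨x, y⟩ · z, w⟩`, the right one after imprimitivity. All
rank one statements derive from this identity. -/
theorem apply_mul_apply (hM : IsImprimitivityBimodule A B M) (ω : Sp A) (x y z w : M) :
    ω (leftInner x y) * ω (leftInner z w) =
      ω (hM.algEquiv.symm (rightInner y z)) * ω (leftInner x w) := by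
  rw [← map_mul, ← map_mul, ← hM.left.smul_left, ← hM.left.smul_left, hM.algEquiv_symm_smul,
    hM.imprimitivity]

theorem apply_leftInner_symm (hM : IsImprimitivityBimodule A B M) (ω : Sp A) (x y : M) :
    ω (leftInner y x) = star (ω (leftInner x y)) := by
  rw [hM.left.symm, map_star]

theorem exists_apply_leftInner_eq_one (hM : IsImprimitivityBimodule A B M) (ω : Sp A) :
    ∃ x : M, ω (leftInner x x) = 1 := by
  obtain ⟨u, v, huv⟩ : ∃ u v : M, ω (leftInner u v) ≠ 0 := by
    obtain ⟨s, u, v, h1⟩ := hM.exists_sum_leftInner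
    by_contra! h
    have : ω 1 = 0 := by rw [← h1, map_sum]; exact Finset.sum_eq_zero fun i _ => h _ _
    simp at this
  -- The product formula gives `|ω(ₐ⟨u, v⟩)|²` the factor `ω(ₐ⟨u, u⟩)`.
  have huu : ω (leftInner u u) ≠ 0 := by
    intro h
    have h2 := hM.apply_mul_apply ω u v v u
    rw [h, mul_zero, hM.apply_leftInner_symm ω u v] at h2
    exact mul_ne_zero huv (star_ne_zero.2 huv) h2
  obtain ⟨a, ha⟩ := hM.left.nonneg u
  rw [ha, map_mul, map_star] at huu
  have ha0 : ω a ≠ 0 := right_ne_zero_of_mul huu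
  set k : A := algebraMap ℂ A (ω a)⁻¹
  have hωk : ω k = (ω a)⁻¹ := AlgHomClass.commutes ω _
  refine ⟨k • u, ?_⟩
  rw [hM.left.smul_left, map_mul, hM.apply_leftInner_symm, hM.left.smul_left, map_mul, ha, map_mul,
    map_star, hωk]
  have hs : star (ω a) ≠ 0 := star_ne_zero.2 ha0
  simp only [star_mul, star_inv₀, star_star]
  field_simp

/-- Two instances of the product formula share the factor `ω(e⁻¹⟨x, z⟩_B)`: one identifies it with
`ω(ₐ⟨z, x⟩)`, the other expresses `ω(ₐ⟨z, w⟩)` through it. -/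
theorem apply_leftInner_eq (hM : IsImprimitivityBimodule A B M) {ω : Sp A} {x : M}
    (hx : ω (leftInner x x) = 1) (z w : M) :
    ω (leftInner z w) = ω (leftInner z x) * star (ω (leftInner w x)) := by
  have h1 := hM.apply_mul_apply ω x x z w
  have h2 := hM.apply_mul_apply ω x x z x
  rw [hx, one_mul] at h1 h2
  rw [h1, h2, mul_one, ← hM.apply_leftInner_symm]

/-- By Gelfand injectivity it suffices to compare values at characters, where a unit vector `x`
reduces both sides to `ω(ₐ⟨x, y⟩) ω(ₐ⟨z, x⟩)`. -/
theorem algEquiv_symm_rightInner (hM : IsImprimitivityBimodule A B M) (y z : M) :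
    hM.algEquiv.symm (rightInner y z) = leftInner z y := by
  refine (gelfandTransform_isometry A).injective (ContinuousMap.ext fun ω => ?_)
  change ω _ = ω _
  obtain ⟨x, hx⟩ := hM.exists_apply_leftInner_eq_one ω
  have h := hM.apply_mul_apply ω x y z x
  rw [hx, mul_one] at h
  rw [← h, hM.apply_leftInner_eq hx z y, hM.apply_leftInner_symm ω y x, mul_comm]

end IsImprimitivityBimodule

/-! ### The homeomorphism of spectra -/

/-- The homeomorphism of spectra `ω ↦ ω ∘ e⁻¹` given by an isomorphism of algebras. -/
def AlgEquiv.spectrumHomeomorph {A : Type uA} {B : Type uB} [CommCStarAlgebra A]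
    [CommCStarAlgebra B] (e : A ≃ₐ[ℂ] B) : Sp A ≃ₜ Sp B where
  -- Algebra homomorphisms to `ℂ` are automatically continuous, so compatibility of `e` with the
  -- involutions is not needed.
  toFun ω := WeakDual.CharacterSpace.equivAlgHom.symm
    ((WeakDual.CharacterSpace.equivAlgHom ω).comp (e.symm : B →ₐ[ℂ] A))
  invFun ω := WeakDual.CharacterSpace.equivAlgHom.symm
    ((WeakDual.CharacterSpace.equivAlgHom ω).comp (e : A →ₐ[ℂ] B))
  left_inv ω := WeakDual.CharacterSpace.ext fun a => congrArg ω (e.symm_apply_apply a)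
  right_inv ω := WeakDual.CharacterSpace.ext fun b => congrArg ω (e.apply_symm_apply b)
  continuous_toFun := continuous_induced_rng.2 <| WeakDual.continuous_of_continuous_eval fun b =>
    (WeakDual.eval_continuous (e.symm b)).comp continuous_subtype_val
  continuous_invFun := continuous_induced_rng.2 <| WeakDual.continuous_of_continuous_eval fun a =>
    (WeakDual.eval_continuous (e a)).comp continuous_subtype_val

theorem AlgEquiv.spectrumHomeomorph_apply {A : Type uA} {B : Type uB} [CommCStarAlgebra A]
    [CommCStarAlgebra B] (e : A ≃ₐ[ℂ] B) (ω : Sp A) (b : B) :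
    e.spectrumHomeomorph ω b = ω (e.symm b) := rfl

/-- Both conditions amount to `a = e⁻¹ b`: the first by faithfulness, the second by injectivity of
the Gelfand transform. -/
theorem IsImprimitivityBimodule.isInducedBy {A : Type uA} {B : Type uB} {M : Type uM}
    [CommCStarAlgebra A] [CommCStarAlgebra B] [AddCommGroup M] [Module ℂ M] [Module A M]
    [Module Bᵐᵒᵖ M] [SMulCommClass A Bᵐᵒᵖ M] [IsScalarTower ℂ A M] [IsScalarTower ℂ Bᵐᵒᵖ M]
    [LeftInner A M] [RightInner B M] (hM : IsImprimitivityBimodule A B M) :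
    IsInducedBy hM.algEquiv.spectrumHomeomorph M := by
  intro a b
  simp_rw [AlgEquiv.spectrumHomeomorph_apply]
  constructor
  · intro h ω
    refine congrArg ω (hM.left_faithful fun x => ?_)
    rw [h, hM.algEquiv_symm_smul]
  · intro h x
    have : a = hM.algEquiv.symm b :=
      (gelfandTransform_isometry A).injective (ContinuousMap.ext h)
    rw [this, hM.algEquiv_symm_smul]

/-- The homeomorphism over whose graph a bimodule is realized as sections of a line bundle is the
one induced by the bimodule. -/
theorem IsInducedBy.eq_of_iso {A : Type uA} {B : Type uB} {M : Type uM} [CommCStarAlgebra A]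
    [CommCStarAlgebra B] [AddCommGroup M] [Module ℂ M] [Module A M] [Module Bᵐᵒᵖ M]
    [LeftInner A M] [RightInner B M] {R R' : Sp A ≃ₜ Sp B} (hR : IsInducedBy R M)
    {E' : HermitianLineBundle.{max uA uB, uE} R'.Graph}
    (Φ : HilbertBimoduleIso A B M (TwistedSections R' E')) : R' = R := by
  refine Homeomorph.ext fun ω => WeakDual.CharacterSpace.ext fun b => ?_
  -- This `a` has the same pull-back as `b`, so the two act equally on sections over the graph of
  -- `R'`.
  set a : A := (pullbackLeft R').symm (pullbackRight R' b)
  have hab : pullbackLeft R' a = pullbackRight R' b := StarAlgEquiv.apply_symm_apply _ _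
  have h : ∀ x : M, a • x = MulOpposite.op b • x := by
    intro x
    apply Φ.toLinearEquiv.injective
    refine (Φ.map_smul_left a x).trans (Eq.trans ?_ (Φ.map_smul_right b x).symm)
    refine Subtype.ext (funext fun p => ?_)
    exact congrArg (fun f : C(R'.Graph, ℂ) => f p • (show E'.sections from Φ.toFun x).1 p) hab
  rw [← (hR a b).1 h ω]
  exact (congrArg (fun f : C(R'.Graph, ℂ) => f ⟨(ω, R' ω), rfl⟩) hab).symm


/-! ### Isomorphisms of line bundles from isomorphisms of sections -/

namespace HermitianLineBundle

variable {X : Type uX} [TopologicalSpace X] {E : HermitianLineBundle.{uX, uE} X}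
  {E' : HermitianLineBundle.{uX, uE'} X}

/-- The fibres of a line bundle are spanned by any nonzero vector. -/
theorem exists_smul_eq {x : X} {v : E.Fiber x} (hv : v ≠ 0) (w : E.Fiber x) :
    ∃ c : ℂ, c • v = w := by
  let e := (trivializationAt ℂ E.Fiber x).linearEquivAt ℂ x
    (FiberBundle.mem_baseSet_trivializationAt ℂ E.Fiber x)
  have he : e v ≠ 0 := fun h => hv (e.map_eq_zero_iff.1 h)
  refine ⟨e w / e v, e.injective ?_⟩
  rw [map_smul, smul_eq_mul, div_mul_cancel₀ _ he]

/-- A fibrewise linear map that takes continuous sections to continuous sections is continuous,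
provided that the continuous sections of the source do not all vanish at any point. -/
theorem continuous_of_map_sections (hE : ∀ x, ∃ s : E.sections, s.1 x ≠ 0)
    (f : ∀ x, E.Fiber x →ₗ[ℂ] E'.Fiber x)
    (hf : ∀ s : E.sections, E'.IsContinuousSection fun x => f x (s.1 x)) :
    Continuous fun v : TotalSpace ℂ E.Fiber =>
      (⟨v.proj, f v.proj v.2⟩ : TotalSpace ℂ E'.Fiber) := by
  refine continuous_iff_continuousAt.2 fun v₀ => ?_
  obtain ⟨s, hs⟩ := hE v₀.proj
  have hproj : Continuous (TotalSpace.proj : TotalSpace ℂ E.Fiber → X) :=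
    FiberBundle.continuous_proj ℂ E.Fiber
  refine (FiberBundle.continuousAt_totalSpace ℂ _).2 ⟨hproj.continuousAt, ?_⟩
  set e := trivializationAt ℂ E.Fiber v₀.proj
  set e' := trivializationAt ℂ E'.Fiber v₀.proj
  have hm : v₀.proj ∈ e.baseSet := FiberBundle.mem_baseSet_trivializationAt ℂ E.Fiber _
  have hm' : v₀.proj ∈ e'.baseSet := FiberBundle.mem_baseSet_trivializationAt ℂ E'.Fiber _
  have hs1 : ContinuousAt (fun x => (e ⟨x, s.1 x⟩).2) v₀.proj :=
    (FiberBundle.continuousAt_section ℂ _).1 s.2.continuousAt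
  have hs2 : ContinuousAt (fun x => (e' ⟨x, f x (s.1 x)⟩).2) v₀.proj :=
    (FiberBundle.continuousAt_section ℂ _).1 (hf s).continuousAt
  have hne : (e ⟨v₀.proj, s.1 v₀.proj⟩).2 ≠ 0 := fun h =>
    hs ((e.linearEquivAt ℂ _ hm).map_eq_zero_iff.1 h)
  have hv : ContinuousAt (fun v : TotalSpace ℂ E.Fiber => (e v).2) v₀ :=
    ((FiberBundle.continuousAt_totalSpace ℂ _).1 continuousAt_id).2
  have hs1' := ContinuousAt.comp (f := TotalSpace.proj) (x := v₀) hs1 hproj.continuousAt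
  have hs2' := ContinuousAt.comp (f := TotalSpace.proj) (x := v₀) hs2 hproj.continuousAt
  -- Near `v₀` each vector is a multiple of the value of `s`, with factor the quotient of
  -- coordinates; by linearity its image is the same multiple of the continuous section `f s`.
  refine ((hv.div hs1' hne).mul hs2').congr_of_eventuallyEq ?_
  filter_upwards [hproj.continuousAt.eventually (e.open_baseSet.mem_nhds hm),
    hproj.continuousAt.eventually (e'.open_baseSet.mem_nhds hm'), hs1'.eventually_ne hne]
    with v h1 h2 h3
  set c : ℂ := (e v).2 / (e ⟨v.proj, s.1 v.proj⟩).2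
  have hv2 : v.2 = c • s.1 v.proj := by
    apply (e.linearEquivAt ℂ _ h1).injective
    rw [map_smul]
    exact (div_mul_cancel₀ _ h3).symm
  change (e'.linearEquivAt ℂ _ h2) (f v.proj v.2) = c * (e'.linearEquivAt ℂ _ h2) (f _ (s.1 v.proj))
  rw [hv2, map_smul, map_smul, smul_eq_mul]

theorem exists_section_eq (hE : ∀ x, ∃ s : E.sections, s.1 x ≠ 0) (x : X) (v : E.Fiber x) :
    ∃ s : E.sections, s.1 x = v := by
  obtain ⟨s, hs⟩ := hE x
  obtain ⟨c, hc⟩ := exists_smul_eq hs v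
  exact ⟨c • s, hc⟩

/-- The value at `x` of the image under `Φ` of any section through `v`. -/
def fiberMap (hE : ∀ x, ∃ s : E.sections, s.1 x ≠ 0) (Φ : E.sections ≃ₗ[ℂ] E'.sections) (x : X)
    (v : E.Fiber x) : E'.Fiber x :=
  (Φ (exists_section_eq hE x v).choose).1 x

/-- Independence of the chosen section: the difference of two sections through one vector vanishes
at `x`, and so does its image, by preservation of norms. -/
theorem fiberMap_apply (hE : ∀ x, ∃ s : E.sections, s.1 x ≠ 0) {Φ : E.sections ≃ₗ[ℂ] E'.sections}
    (hΦ : ∀ s x, ‖(Φ s).1 x‖ = ‖s.1 x‖) (s : E.sections) (x : X) :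
    fiberMap hE Φ x (s.1 x) = (Φ s).1 x := by
  set t := (exists_section_eq hE x (s.1 x)).choose
  have h : t.1 x = s.1 x := (exists_section_eq hE x (s.1 x)).choose_spec
  have h2 := hΦ (t - s) x
  have h3 : (t - s).1 x = 0 := sub_eq_zero.2 h
  rw [h3, norm_zero, norm_eq_zero, map_sub] at h2
  exact sub_eq_zero.1 h2

/-- The unitary map of fibres induced by a norm-preserving isomorphism of spaces of sections. -/
def fiberIsometry (hE : ∀ x, ∃ s : E.sections, s.1 x ≠ 0) (Φ : E.sections ≃ₗ[ℂ] E'.sections)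
    (hΦ : ∀ s x, ‖(Φ s).1 x‖ = ‖s.1 x‖) (x : X) : E.Fiber x →ₗᵢ[ℂ] E'.Fiber x where
  toFun := fiberMap hE Φ x
  map_add' v w := by
    obtain ⟨s, rfl⟩ := exists_section_eq hE x v
    obtain ⟨t, rfl⟩ := exists_section_eq hE x w
    rw [fiberMap_apply hE hΦ, fiberMap_apply hE hΦ]
    refine (fiberMap_apply hE hΦ (s + t) x).trans ?_
    rw [map_add]
    rfl
  map_smul' c v := by
    obtain ⟨s, rfl⟩ := exists_section_eq hE x v
    rw [fiberMap_apply hE hΦ]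
    refine (fiberMap_apply hE hΦ (c • s) x).trans ?_
    rw [map_smul]
    rfl
  norm_map' v := by
    obtain ⟨s, rfl⟩ := exists_section_eq hE x v
    exact (congrArg norm (fiberMap_apply hE hΦ s x)).trans (hΦ s x)

theorem fiberIsometry_apply (hE : ∀ x, ∃ s : E.sections, s.1 x ≠ 0)
    {Φ : E.sections ≃ₗ[ℂ] E'.sections} (hΦ : ∀ s x, ‖(Φ s).1 x‖ = ‖s.1 x‖) (s : E.sections)
    (x : X) : fiberIsometry hE Φ hΦ x (s.1 x) = (Φ s).1 x :=
  fiberMap_apply hE hΦ s x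

/-- An isomorphism of spaces of sections that preserves pointwise norms comes from an isomorphism
of line bundles, provided that the sections do not all vanish at any point. -/
theorem nonempty_iso_of_sections (hE : ∀ x, ∃ s : E.sections, s.1 x ≠ 0)
    (Φ : E.sections ≃ₗ[ℂ] E'.sections) (hΦ : ∀ s x, ‖(Φ s).1 x‖ = ‖s.1 x‖) :
    Nonempty (E.Iso E') := by
  have hE' : ∀ x, ∃ s : E'.sections, s.1 x ≠ 0 := fun x => by
    obtain ⟨s, hs⟩ := hE x
    exact ⟨Φ s, by rwa [← norm_ne_zero_iff, hΦ, norm_ne_zero_iff]⟩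
  have hsurj : ∀ x, Function.Surjective (fiberIsometry hE Φ hΦ x) := fun x w => by
    obtain ⟨t, rfl⟩ := exists_section_eq hE' x w
    refine ⟨(Φ.symm t).1 x, ?_⟩
    rw [fiberIsometry_apply, LinearEquiv.apply_symm_apply]
  let u : ∀ x, E.Fiber x ≃ₗᵢ[ℂ] E'.Fiber x := fun x =>
    LinearIsometryEquiv.ofSurjective (fiberIsometry hE Φ hΦ x) (hsurj x)
  have hu : ∀ (s : E.sections) x, u x (s.1 x) = (Φ s).1 x := fiberIsometry_apply hE hΦ
  have hu' : ∀ (t : E'.sections) x, (u x).symm (t.1 x) = (Φ.symm t).1 x := fun t x => by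
    rw [LinearIsometryEquiv.symm_apply_eq, hu, LinearEquiv.apply_symm_apply]
  refine ⟨⟨u, ?_, ?_⟩⟩
  · refine continuous_of_map_sections (E' := E') hE (fun x => ((u x).toLinearEquiv : _ →ₗ[ℂ] _))
      fun s => ?_
    exact (congrArg E'.IsContinuousSection (funext (hu s))).mpr (Φ s).2
  · refine continuous_of_map_sections (E' := E) hE' (fun x => ((u x).symm.toLinearEquiv : _ →ₗ[ℂ] _))
      fun t => ?_
    exact (congrArg E.IsContinuousSection (funext (hu' t))).mpr (Φ.symm t).2

end HermitianLineBundle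

/-! ### Line bundles from rank one Gram matrices -/

/-- A continuous family of Hermitian Gram matrices of rank one, indexed by the points of the base
and normalized so that the vector indexed by `p` is a unit vector at `p`. -/
structure RankOneGram (X : Type uX) [TopologicalSpace X] where
  /-- the inner product at `p` of the vectors indexed by `i` and `j` -/
  gram : X → X → X → ℂ
  continuous_gram : ∀ i j, Continuous (gram i j)
  mul_gram : ∀ i j k l p, gram i j p * gram k l p = gram i l p * gram k j p
  gram_symm : ∀ i j p, gram j i p = star (gram i j p)
  gram_self : ∀ p, gram p p p = 1

namespace RankOneGram

variable {X : Type uX} [TopologicalSpace X] (G : RankOneGram X)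

/-- The vector bundle core with frames the indexed vectors, over the sets where they do not
vanish. -/
def core : VectorBundleCore ℂ X ℂ X where
  baseSet i := {p | G.gram i i p ≠ 0}
  isOpen_baseSet i := isOpen_ne_fun (G.continuous_gram i i) continuous_const
  indexAt p := p
  mem_baseSet_at p := by simp [G.gram_self]
  -- In a line, `e_i = (⟨e_i, e_j⟩ / ⟨e_j, e_j⟩) e_j`, with the product linear in the first
  -- variable.
  coordChange i j p := (G.gram i j p / G.gram j j p) • ContinuousLinearMap.id ℂ ℂ
  coordChange_self i p hp v := by
    have hp : G.gram i i p ≠ 0 := hp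
    simp [div_self hp]
  continuousOn_coordChange i j :=
    ((G.continuous_gram i j).continuousOn.div (G.continuous_gram j j).continuousOn
      fun p hp => hp.2).smul continuousOn_const
  coordChange_comp i j k p hp v := by
    obtain ⟨⟨-, hj⟩, hk⟩ := hp
    have hj : G.gram j j p ≠ 0 := hj
    have hk : G.gram k k p ≠ 0 := hk
    simp only [smul_apply, ContinuousLinearMap.id_apply, smul_eq_mul]
    have h := G.mul_gram i j j k p
    field_simp
    linear_combination v * h

/-- Equality in Cauchy–Schwarz, as `e_p` and `e_i` are proportional at `p` and `e_p` has length one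
there. -/
theorem norm_gram (i p : X) : ‖G.gram p i p‖ = √‖G.gram i i p‖ := by
  have h := G.mul_gram p i i p p
  rw [G.gram_self, one_mul, G.gram_symm p i p] at h
  rw [← h, norm_mul, norm_star, Real.sqrt_mul_self (norm_nonneg _)]

theorem continuous_norm :
    Continuous fun v : TotalSpace ℂ G.core.Fiber => ‖(show ℂ from v.2)‖ := by
  refine continuous_iff_continuousAt.2 fun v₀ => ?_
  set i := v₀.proj with hi
  have hproj : Continuous (TotalSpace.proj : TotalSpace ℂ G.core.Fiber → X) :=
    FiberBundle.continuous_proj ℂ G.core.Fiber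
  have hv : ContinuousAt
      (fun v : TotalSpace ℂ G.core.Fiber => (trivializationAt ℂ G.core.Fiber i v).2) v₀ :=
    ((FiberBundle.continuousAt_totalSpace ℂ _).1 continuousAt_id).2
  have hg : Continuous fun v : TotalSpace ℂ G.core.Fiber => √‖G.gram i i v.proj‖ :=
    ((G.continuous_gram i i).comp hproj).norm.sqrt
  refine (hv.norm.mul hg.continuousAt).congr_of_eventuallyEq ?_
  have hne : ∀ᶠ v : TotalSpace ℂ G.core.Fiber in 𝓝 v₀, G.gram i i v.proj ≠ 0 :=
    ((G.continuous_gram i i).comp hproj).continuousAt.eventually_ne (by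
      simp [← hi, G.gram_self])
  filter_upwards [hne] with v hv
  have hpos : 0 < ‖G.gram i i v.proj‖ := norm_pos_iff.2 hv
  -- The norm of `c e_p` is that of its coordinate along `e_i` times the length of `e_i`.
  have key : ∀ c : ℂ, ‖c‖ =
      ‖G.gram v.proj i v.proj / G.gram i i v.proj * c‖ * √‖G.gram i i v.proj‖ := fun c => by
    rw [norm_mul, norm_div, norm_gram, mul_right_comm, div_mul_eq_mul_div,
      Real.mul_self_sqrt hpos.le, div_self hpos.ne', one_mul]
  exact key v.2

/-- The Hermitian line bundle of a rank one Gram matrix; its fibre at `p` is identified with `ℂ`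
through the unit vector indexed by `p`. -/
def lineBundle : HermitianLineBundle.{uX, 0} X where
  Fiber := G.core.Fiber
  normedAddCommGroup _ := inferInstanceAs (NormedAddCommGroup ℂ)
  innerProductSpace _ := inferInstanceAs (InnerProductSpace ℂ ℂ)
  topologicalSpace := G.core.toTopologicalSpace
  fiberBundle := G.core.fiberBundle
  vectorBundle := G.core.vectorBundle
  continuous_norm := G.continuous_norm

/-- The hypothesis concerns the pairings of `s` with each `e_i`; division by `⟨e_i, e_i⟩`, which is
`1` at `i`, gives the local coordinate near `i`. -/
theorem isContinuousSection {s : X → ℂ} (hs : ∀ i, Continuous fun p => s p * G.gram p i p) :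
    G.lineBundle.IsContinuousSection s := by
  refine continuous_iff_continuousAt.2 fun i => ?_
  refine (FiberBundle.continuousAt_section ℂ (E := G.core.Fiber) i).2 ?_
  refine ((hs i).continuousAt.div (G.continuous_gram i i).continuousAt
    (by rw [G.gram_self]; exact one_ne_zero)).congr_of_eventuallyEq (.of_forall fun p => ?_)
  exact div_mul_comm _ _ _ |>.trans (div_mul_eq_mul_div _ _ _)

theorem inner_lineBundle (p : X) (v w : G.lineBundle.Fiber p) :
    inner ℂ v w = star (show ℂ from v) * (show ℂ from w) := mul_comm _ _

end RankOneGram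

/-! ### Isomorphisms with twisted bimodules of sections -/

namespace HilbertBimoduleIso

variable {A : Type uA} {B : Type uB} {M : Type uM} [CommCStarAlgebra A] [CommCStarAlgebra B]
    [AddCommGroup M] [Module ℂ M] [Module A M] [Module Bᵐᵒᵖ M] [LeftInner A M] [RightInner B M]
    {R : Sp A ≃ₜ Sp B} {E : HermitianLineBundle.{max uA uB, uE} R.Graph}
    {E' : HermitianLineBundle.{max uA uB, uE'} R.Graph}

/-- An isomorphism with a twisted bimodule of sections, from its pointwise properties. -/
def ofSections (e : M ≃ₗ[ℂ] E.sections)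
    (hleft : ∀ (a : A) x p, (e (a • x)).1 p = p.1.1 a • (e x).1 p)
    (hright : ∀ (b : B) x p, (e (MulOpposite.op b • x)).1 p = p.1.2 b • (e x).1 p)
    (hinner_left : ∀ x y p, inner ℂ ((e y).1 p) ((e x).1 p) = p.1.1 (leftInner x y : A))
    (hinner_right : ∀ x y p, inner ℂ ((e x).1 p) ((e y).1 p) = p.1.2 (rightInner x y : B)) :
    HilbertBimoduleIso A B M (TwistedSections R E) where
  toLinearEquiv := e
  map_smul_left a x := Subtype.ext <| funext <| hleft a x
  map_smul_right b x := Subtype.ext <| funext <| hright b x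
  map_leftInner x y := (StarAlgEquiv.symm_apply_eq _).2 <| ContinuousMap.ext <| hinner_left x y
  map_rightInner x y := (StarAlgEquiv.symm_apply_eq _).2 <| ContinuousMap.ext <| hinner_right x y

/-- The linear equivalence with the space of sections underlying an isomorphism with a twisted
bimodule of sections. -/
def toSections (Φ : HilbertBimoduleIso A B M (TwistedSections R E)) : M ≃ₗ[ℂ] E.sections :=
  Φ.toLinearEquiv

theorem inner_toSections (Φ : HilbertBimoduleIso A B M (TwistedSections R E)) (x y : M)
    (p : R.Graph) :
    inner ℂ ((Φ.toSections y).1 p) ((Φ.toSections x).1 p) = p.1.1 (leftInner x y : A) :=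
  congrArg (fun f : C(R.Graph, ℂ) => f p) ((StarAlgEquiv.symm_apply_eq _).1 (Φ.map_leftInner x y))

theorem norm_sq_toSections (Φ : HilbertBimoduleIso A B M (TwistedSections R E)) (x : M)
    (p : R.Graph) : ((‖(Φ.toSections x).1 p‖ ^ 2 : ℝ) : ℂ) = p.1.1 (leftInner x x : A) := by
  rw [← Φ.inner_toSections, Complex.ofReal_pow]
  exact (inner_self_eq_norm_sq_to_K (𝕜 := ℂ) ((Φ.toSections x).1 p)).symm

/-- Line bundles whose twisted bimodules of sections are isomorphic to one and the same bimodule,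
nonzero at every character, are isomorphic. -/
theorem nonempty_lineBundle_iso (hM : ∀ ω : Sp A, ∃ x : M, ω (leftInner x x) = 1)
    (Φ : HilbertBimoduleIso A B M (TwistedSections R E))
    (Φ' : HilbertBimoduleIso A B M (TwistedSections R E')) : Nonempty (E.Iso E') := by
  refine HermitianLineBundle.nonempty_iso_of_sections (fun p => ?_)
    (Φ.toSections.symm.trans Φ'.toSections) fun s p => ?_
  · obtain ⟨x, hx⟩ := hM p.1.1
    refine ⟨Φ.toSections x, fun h => ?_⟩
    have h2 := Φ.norm_sq_toSections x p
    rw [hx, h, norm_zero] at h2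
    simp at h2
  · obtain ⟨x, rfl⟩ := Φ.toSections.surjective s
    rw [LinearEquiv.trans_apply, LinearEquiv.symm_apply_apply]
    exact (sq_eq_sq₀ (norm_nonneg _) (norm_nonneg _)).1 (Complex.ofReal_injective
      ((Φ'.norm_sq_toSections x p).trans (Φ.norm_sq_toSections x p).symm))

end HilbertBimoduleIso

/-! ### The spectral theorem -/

namespace IsImprimitivityBimodule

variable {A : Type uA} {B : Type uB} {M : Type uM} [CommCStarAlgebra A] [CommCStarAlgebra B]
    [AddCommGroup M] [Module ℂ M] [Module A M] [Module Bᵐᵒᵖ M]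
    [SMulCommClass A Bᵐᵒᵖ M] [IsScalarTower ℂ A M] [IsScalarTower ℂ Bᵐᵒᵖ M]
    [LeftInner A M] [RightInner B M]

/-- An element of `M` that is a unit vector at the character `ω`. -/
def unitVector (hM : IsImprimitivityBimodule A B M) (ω : Sp A) : M :=
  (hM.exists_apply_leftInner_eq_one ω).choose

theorem apply_unitVector (hM : IsImprimitivityBimodule A B M) (ω : Sp A) :
    ω (leftInner (hM.unitVector ω) (hM.unitVector ω)) = 1 :=
  (hM.exists_apply_leftInner_eq_one ω).choose_spec

theorem continuous_apply {R : Sp A ≃ₜ Sp B} (a : A) : Continuous fun p : R.Graph => p.1.1 a :=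
  (pullbackLeft R a).continuous

/-- The Gram matrices, at the points of the graph of `R`, of the chosen unit vectors. -/
def gram (hM : IsImprimitivityBimodule A B M) (R : Sp A ≃ₜ Sp B) : RankOneGram R.Graph where
  gram i j p := p.1.1 (leftInner (hM.unitVector i.1.1) (hM.unitVector j.1.1))
  continuous_gram i j := continuous_apply _
  mul_gram i j k l p := by
    have h := hM.apply_leftInner_eq (hM.apply_unitVector p.1.1)
    rw [h (hM.unitVector i.1.1), h (hM.unitVector k.1.1),
      h (hM.unitVector i.1.1) (hM.unitVector l.1.1), h (hM.unitVector k.1.1) (hM.unitVector j.1.1)]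
    ring
  gram_symm i j p := hM.apply_leftInner_symm _ _ _
  gram_self p := hM.apply_unitVector _

/-- The continuous section `p ↦ p(ₐ⟨x, e_p⟩)` given by `x`, where `e_p` is the unit vector chosen
at `p`. -/
def toSection (hM : IsImprimitivityBimodule A B M) (R : Sp A ≃ₜ Sp B) (x : M) :
    (hM.gram R).lineBundle.sections :=
  ⟨fun p => p.1.1 (leftInner x (hM.unitVector p.1.1)), (hM.gram R).isContinuousSection fun i => by
    -- By rank one, the pairing with `e_i` is `p(ₐ⟨x, e_i⟩)`, from which the arbitrary choice of
    -- `e_p` has disappeared.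
    refine (continuous_apply (leftInner x (hM.unitVector i.1.1))).congr fun p => ?_
    rw [hM.apply_leftInner_eq (hM.apply_unitVector p.1.1)]
    exact congrArg _ (hM.apply_leftInner_symm _ _ _).symm⟩

theorem inner_toSection (hM : IsImprimitivityBimodule A B M) (R : Sp A ≃ₜ Sp B) (x y : M)
    (p : R.Graph) :
    inner ℂ ((hM.toSection R x).1 p) ((hM.toSection R y).1 p) = p.1.1 (leftInner y x) := by
  rw [hM.apply_leftInner_eq (hM.apply_unitVector p.1.1), RankOneGram.inner_lineBundle, mul_comm]
  rfl

theorem leftInner_smul (hM : IsImprimitivityBimodule A B M) (c : ℂ) (x y : M) :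
    (leftInner (c • x) y : A) = c • leftInner x y := by
  rw [← one_smul A x, ← smul_assoc, hM.left.smul_left, smul_mul_assoc, one_mul, one_smul]

/-- `toSection` as a linear map. -/
def toSectionHom (hM : IsImprimitivityBimodule A B M) (R : Sp A ≃ₜ Sp B) :
    M →ₗ[ℂ] (hM.gram R).lineBundle.sections where
  toFun := hM.toSection R
  map_add' _ _ := Subtype.ext <| funext fun p =>
    (congrArg p.1.1 (hM.left.add_left _ _ _)).trans (map_add p.1.1 _ _)
  map_smul' c x := Subtype.ext <| funext fun p =>
    (congrArg p.1.1 (hM.leftInner_smul c x _)).trans (map_smul p.1.1 c _)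

theorem toSectionHom_injective (hM : IsImprimitivityBimodule A B M) (R : Sp A ≃ₜ Sp B) :
    Function.Injective (hM.toSectionHom R) := by
  refine (injective_iff_map_eq_zero _).2 fun x hx => hM.left.definite x ?_
  refine (gelfandTransform_isometry A).injective (ContinuousMap.ext fun ω => ?_)
  have h : (hM.toSection R x).1 ⟨(ω, R ω), rfl⟩ = 0 :=
    congrFun (congrArg Subtype.val hx) ⟨(ω, R ω), rfl⟩
  have h2 := hM.inner_toSection R x x ⟨(ω, R ω), rfl⟩
  rw [h, inner_zero_left] at h2
  exact h2.symm.trans (map_zero ω).symm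

/-- Frame reconstruction: since `∑ ₐ⟨uᵢ, vᵢ⟩ = 1`, every section satisfies `t = ∑ ⟨vᵢ, t⟩ uᵢ`, and
the coefficients, continuous functions on the graph, come from `A`. -/
theorem toSectionHom_surjective (hM : IsImprimitivityBimodule A B M) (R : Sp A ≃ₜ Sp B) :
    Function.Surjective (hM.toSectionHom R) := by
  intro t
  obtain ⟨s, u, v, h1⟩ := hM.exists_sum_leftInner
  let f : M × M → C(R.Graph, ℂ) := fun i =>
    ⟨fun p => inner ℂ ((hM.toSection R (v i)).1 p) (t.1 p),
      HermitianLineBundle.continuous_inner _ (hM.toSection R (v i)) t⟩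
  refine ⟨∑ i ∈ s, (pullbackLeft R).symm (f i) • u i, Subtype.ext (funext fun p => ?_)⟩
  have hf : ∀ i, p.1.1 ((pullbackLeft R).symm (f i)) =
      star (p.1.1 (leftInner (v i) (hM.unitVector p.1.1))) * (show ℂ from t.1 p) := fun i =>
    (congrArg (fun g : C(R.Graph, ℂ) => g p)
      (StarAlgEquiv.apply_symm_apply (pullbackLeft R) (f i))).trans
      (RankOneGram.inner_lineBundle _ p _ _)
  have h2 : ∑ i ∈ s, p.1.1 (leftInner (u i) (v i) : A) = 1 := by rw [← map_sum, h1, map_one]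
  change p.1.1 (leftInner _ _) = (show ℂ from t.1 p)
  rw [hM.left.sum_left, map_sum, ← one_mul (show ℂ from t.1 p), ← h2, Finset.sum_mul]
  refine Finset.sum_congr rfl fun i _ => ?_
  rw [hM.left.smul_left, map_mul, hf, hM.apply_leftInner_eq (hM.apply_unitVector p.1.1) (u i) (v i)]
  ring

theorem toSection_smul (hM : IsImprimitivityBimodule A B M) (R : Sp A ≃ₜ Sp B) (a : A) (x : M)
    (p : R.Graph) : (hM.toSection R (a • x)).1 p = p.1.1 a • (hM.toSection R x).1 p :=
  (congrArg p.1.1 (hM.left.smul_left _ _ _)).trans (map_mul p.1.1 _ _)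

/-- `toSection` as a linear equivalence. -/
def toSectionEquiv (hM : IsImprimitivityBimodule A B M) (R : Sp A ≃ₜ Sp B) :
    M ≃ₗ[ℂ] (hM.gram R).lineBundle.sections :=
  LinearEquiv.ofBijective (hM.toSectionHom R)
    ⟨hM.toSectionHom_injective R, hM.toSectionHom_surjective R⟩

/-- An imprimitivity bimodule is isomorphic to the twisted bimodule of sections of its line
bundle. -/
def isoTwistedSections (hM : IsImprimitivityBimodule A B M) (R : Sp A ≃ₜ Sp B)
    (hR : ∀ (ω : Sp A) (b : B), R ω b = ω (hM.algEquiv.symm b)) :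
    HilbertBimoduleIso A B M (TwistedSections R (hM.gram R).lineBundle) :=
  -- The left structure is matched for any `R`; the right one requires `R` to be induced by `e`.
  have hinner (x y : M) (p : R.Graph) : p.1.1 (leftInner y x : A) = p.1.2 (rightInner x y : B) := by
    rw [p.2, hR, hM.algEquiv_symm_rightInner]
  have hright (b : B) (x : M) (p : R.Graph) : (hM.toSection R (MulOpposite.op b • x)).1 p =
      p.1.2 b • (hM.toSection R x).1 p := by
    rw [← hM.algEquiv_symm_smul, toSection_smul, p.2, hR]
  .ofSections (hM.toSectionEquiv R) (hM.toSection_smul R) hright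
    (fun x y => hM.inner_toSection R y x)
    (fun x y p => (hM.inner_toSection R x y p).trans (hinner x y p))

end IsImprimitivityBimodule

theorem mainTheorem2 (A : Type uA) (B : Type uB) (M : Type uM)
    [CommCStarAlgebra A] [CommCStarAlgebra B]
    [AddCommGroup M] [Module ℂ M] [Module A M] [Module Bᵐᵒᵖ M]
    [SMulCommClass A Bᵐᵒᵖ M] [IsScalarTower ℂ A M] [IsScalarTower ℂ Bᵐᵒᵖ M]
    [LeftInner A M] [RightInner B M]
    (hM : IsImprimitivityBimodule A B M) :
    ∃ R : Sp A ≃ₜ Sp B,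
      IsInducedBy R M ∧
      (∃ E : HermitianLineBundle.{max uA uB, 0} R.Graph,
        Nonempty (HilbertBimoduleIso A B M (TwistedSections R E)) ∧
        ∀ E' : HermitianLineBundle.{max uA uB, uE} R.Graph,
          Nonempty (HilbertBimoduleIso A B M (TwistedSections R E')) → Nonempty (E.Iso E')) ∧
      ∀ (R' : Sp A ≃ₜ Sp B) (E' : HermitianLineBundle.{max uA uB, uE} R'.Graph),
        Nonempty (HilbertBimoduleIso A B M (TwistedSections R' E')) → R' = R :=
  ⟨hM.algEquiv.spectrumHomeomorph, hM.isInducedBy,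
    ⟨_, ⟨hM.isoTwistedSections _ hM.algEquiv.spectrumHomeomorph_apply⟩, fun _ ⟨Φ'⟩ =>
      (hM.isoTwistedSections _ hM.algEquiv.spectrumHomeomorph_apply).nonempty_lineBundle_iso
        hM.exists_apply_leftInner_eq_one Φ'⟩,
    fun _ _ ⟨Φ⟩ => hM.isInducedBy.eq_of_iso Φ⟩
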